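/- Let $\mathbb{K}$ be a field of characteristic $0$ (for instance $\mathbb{Q}$, $\mathbb{R}$ or $\mathbb{C}$), let $d, a \in \mathbb{Z}$ and put $r = -(a+d)$. Let $$H(t)=\sum_{i=0}^\infty \gamma_i (1-t)^{i-d}, \qquad \gamma_i \in \mathbb{K},$$ be a formal Laurent series around $t=1$ of pole order at most $d$, and stipulate $\gamma_i = 0$ for $i<0$. The series $H(t^{-1})$ is obtained from $H(t)$ by the formal substitution of $1-t^{-1} = -\frac{1-t}{1-(1-t)} = -\sum_{k\ge 1}(1-t)^k$ for $1-t$, and $t = 1-(1-t)$ is an invertible formal Laurent series around $t=1$. Then $H(t)$ satisfies the functional equation $$H(t^{-1}) = (-1)^d\, t^{-a} H(t)$$ if and only if all of the following conditions hold. 1. If $r$ is even (positive, negative or zero), then for each $m \ge 1$: $$\sum_{i=0}^{m-1} (-1)^i \binom{m-1}{i} \gamma_{m-r+i} = 0.$$ 2. If $r>0$ is odd, then for each $m\ge 1$: $$\sum_{i=0}^{m} (-1)^i \binom{2m+r-2}{m-i}\binom{m+i}{i} \gamma_{m+i-1} = 0.$$ 3. If $r<0$ (of either parity), then for each $1\le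 m\le \lceil -r/2\rceil$: $$\sum_{i=0}^{m} \binom{m}{i} \binom{1-r}{m+i}^{-1} \gamma_{m+i-1} = 0.$$ 4. If $r<0$ is odd, then for each $m\ge 1$: $$\sum_{i=0}^{m} (-1)^i \binom{m}{i}\, \frac{m+i}{m}\, \gamma_{m-r+i} = 0.$$ -/

import Mathlib

open scoped PowerSeries LaurentSeries

noncomputable section

namespace LaurentAtOne

variable {K : Type*} [Field K]

/-- Formal Laurent series in `t` around `t = 1` are modelled as elements of `K⸨X⸩`, the
variable being the local parameter `X = 1 - t`. This is the element `t = 1 - X`. -/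
def t (K : Type*) [Field K] : K⸨X⸩ := 1 - HahnSeries.single (1 : ℤ) (1 : K)

/-- The local parameter `1 - t` after replacing `t` by `t⁻¹`: the power series
`1 - (1 - X)⁻¹ = X / (X - 1)`, which has order one. -/
def invParam (K : Type*) [Field K] : K⟦X⟧ := 1 - (1 - PowerSeries.X)⁻¹

/-- The formal substitution `X ↦ u` in a Laurent series, where `u` is a nonzero power series
with zero constant term: writing `H = X ^ n * P` with `n` the order of `H` and `P` a power
series, the result is `u ^ n * P(u)`. -/
def substLaurent (u : K⟦X⟧) (H : K⸨X⸩) : K⸨X⸩ :=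
  HahnSeries.ofPowerSeries ℤ K u ^ H.order *
    HahnSeries.ofPowerSeries ℤ K (PowerSeries.subst u H.powerSeriesPart)

/-- The Laurent series `H(t⁻¹)`, expanded again around `t = 1`. -/
def evalInv (H : K⸨X⸩) : K⸨X⸩ := substLaurent (invParam K) H

/-- The functional equation `H(t⁻¹) = (-1) ^ d * t ^ (-a) * H(t)`. -/
def FunctionalEquation (d a : ℤ) (H : K⸨X⸩) : Prop :=
  evalInv H = (-1) ^ d * t K ^ (-a) * H

end LaurentAtOne

end

noncomputable section

namespace LaurentAtOne

open Finset

variable {K : Type*} [Field K]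

/-! Write `H = X ^ (-d) * G` with `X = 1 - t`. Inverting `t` sends `X` to `u = X / (X - 1) = -X *
t⁻¹`, so the monomial `X ^ (-d)` produces the sign `(-1) ^ d` and a power of `t`. The functional
equation thus becomes `G = t ^ (-r) * G(u)`: `G` is a fixed point of the involution `reflect r`. On
coefficients this involution is triangular, with diagonal entries `(-1) ^ n`.

A linear functional that changes sign under the involution vanishes on every fixed point, since the
characteristic is zero. Conversely, `E = reflect r G - G` is negated by the involution. Take its
lowest possibly nonzero coefficient, at index `n`. If `n` is even, triangularity makes it equal to
its own negative. If `n` is odd, a sign-changing functional with leading index `n` that vanishes on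
`G` also vanishes on `E` and kills it. So one such functional for each odd `n` suffices
(`reflect_eq_self_of_forall_odd`).

The four conditions are four families of sign-changing functionals. Each verification reduces to one
finite-difference identity for binomial coefficients, `sum_alternating_choose_mul_choose`. For every
`r`, the applicable families together have all odd leading indices. -/

/-- The power series `(1 - X) ^ s`, for an integer exponent `s`. -/
def oneSubPow (K : Type*) [Field K] (s : ℤ) : K⟦X⟧ :=
  PowerSeries.rescale (-1 : K) (PowerSeries.binomialSeries K s)

lemma coeff_oneSubPow (s : ℤ) (n : ℕ) :
    PowerSeries.coeff n (oneSubPow K s) = (-1) ^ n * ((Ring.choose s n : ℤ) : K) := by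
  simp [oneSubPow, PowerSeries.coeff_rescale]

lemma oneSubPow_add (s s' : ℤ) :
    oneSubPow K (s + s') = oneSubPow K s * oneSubPow K s' := by
  simp [oneSubPow]

@[simp]
lemma oneSubPow_zero : oneSubPow K 0 = 1 := by
  simp [oneSubPow]

lemma oneSubPow_natCast (n : ℕ) : oneSubPow K n = (1 - PowerSeries.X) ^ n := by
  simp [oneSubPow, sub_eq_add_neg]

lemma oneSubPow_mul_neg (s : ℤ) : oneSubPow K s * oneSubPow K (-s) = 1 := by
  rw [← oneSubPow_add]; simp

lemma oneSubPow_one : oneSubPow K 1 = 1 - PowerSeries.X := by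
  simpa using oneSubPow_natCast (K := K) 1

lemma oneSubPow_neg_one : oneSubPow K (-1) = (1 - PowerSeries.X)⁻¹ := by
  rw [PowerSeries.eq_inv_iff_mul_eq_one (by simp), mul_comm]
  simpa [oneSubPow_one] using oneSubPow_mul_neg (K := K) 1

lemma oneSubPow_neg_natCast (n : ℕ) : oneSubPow K (-n) = oneSubPow K (-1) ^ n := by
  induction n with
  | zero => simp
  | succ n ih => rw [pow_succ, ← ih, ← oneSubPow_add]; congr 1; push_cast; ring

lemma ofPowerSeries_oneSubPow (s : ℤ) :
    HahnSeries.ofPowerSeries ℤ K (oneSubPow K s) = t K ^ s := by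
  have hnat (n : ℕ) : HahnSeries.ofPowerSeries ℤ K (oneSubPow K n) = t K ^ n := by
    rw [oneSubPow_natCast, map_pow, map_sub, map_one, HahnSeries.ofPowerSeries_X, t]
  obtain ⟨n, rfl | rfl⟩ := s.eq_nat_or_neg
  · rw [hnat, zpow_natCast]
  · rw [zpow_neg, zpow_natCast, ← hnat]
    refine eq_inv_of_mul_eq_one_right ?_
    rw [← map_mul, oneSubPow_mul_neg, map_one]

/-! ### The substitution inverting `t`. -/

lemma invParam_eq_one_sub : invParam K = 1 - oneSubPow K (-1) := by
  rw [invParam, oneSubPow_neg_one]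

lemma invParam_eq_neg_X_mul : invParam K = -(PowerSeries.X * oneSubPow K (-1)) := by
  have h := oneSubPow_mul_neg (K := K) 1
  rw [oneSubPow_one] at h
  rw [invParam_eq_one_sub]
  linear_combination -h

lemma hasSubst_invParam : PowerSeries.HasSubst (invParam K) := by
  apply PowerSeries.HasSubst.of_constantCoeff_zero'
  simp [invParam_eq_neg_X_mul]

lemma invParam_pow (n : ℕ) :
    invParam K ^ n = (-1) ^ n * (PowerSeries.X ^ n * oneSubPow K (-n)) := by
  rw [invParam_eq_neg_X_mul, neg_pow, mul_pow, oneSubPow_neg_natCast]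

/-- The substitution is a ring homomorphism taking `t` to `t⁻¹`; negative exponents follow by
uniqueness of inverses. -/
lemma subst_invParam_oneSubPow (s : ℤ) :
    PowerSeries.subst (invParam K) (oneSubPow K s) = oneSubPow K (-s) := by
  have hu := hasSubst_invParam (K := K)
  have hone : PowerSeries.subst (invParam K) (1 : K⟦X⟧) = 1 := by
    rw [← PowerSeries.coe_substAlgHom hu, map_one]
  have hnat (n : ℕ) : PowerSeries.subst (invParam K) (oneSubPow K n) = oneSubPow K (-n) := by
    rw [oneSubPow_natCast, PowerSeries.subst_pow hu, PowerSeries.subst_sub hu, hone,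
      PowerSeries.subst_X hu, oneSubPow_neg_natCast, invParam_eq_one_sub]
    simp
  obtain ⟨n, rfl | rfl⟩ := s.eq_nat_or_neg
  · exact hnat n
  · have h : oneSubPow K (-n) * PowerSeries.subst (invParam K) (oneSubPow K (-n)) = 1 := by
      rw [← hnat n, ← PowerSeries.subst_mul hu, hnat n, oneSubPow_mul_neg, hone]
    calc _ = oneSubPow K n * oneSubPow K (-n)
          * PowerSeries.subst (invParam K) (oneSubPow K (-n)) := by
            rw [oneSubPow_mul_neg, one_mul]
      _ = _ := by rw [mul_assoc, h, mul_one, neg_neg]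

lemma subst_invParam_subst (G : K⟦X⟧) :
    PowerSeries.subst (invParam K) (PowerSeries.subst (invParam K) G) = G := by
  have hu := hasSubst_invParam (K := K)
  have hone : PowerSeries.subst (invParam K) (1 : K⟦X⟧) = 1 := by
    rw [← PowerSeries.coe_substAlgHom hu, map_one]
  have huu : PowerSeries.subst (invParam K) (invParam K) = PowerSeries.X := by
    conv_lhs => arg 2; rw [invParam_eq_one_sub (K := K)]
    rw [PowerSeries.subst_sub hu, hone, subst_invParam_oneSubPow, neg_neg, oneSubPow_one,
      sub_sub_cancel]
  rw [PowerSeries.subst_comp_subst_apply hu hu, huu, PowerSeries.X_subst]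

/-! ### The involution and its matrix. -/

/-- The operator `G(X) ↦ (1 - X) ^ (-r) * G(X / (X - 1))` on power series. -/
def reflect (r : ℤ) (G : K⟦X⟧) : K⟦X⟧ :=
  oneSubPow K (-r) * PowerSeries.subst (invParam K) G

lemma reflect_reflect (r : ℤ) (G : K⟦X⟧) : reflect r (reflect r G) = G := by
  rw [reflect, reflect, PowerSeries.subst_mul hasSubst_invParam, subst_invParam_oneSubPow,
    subst_invParam_subst, ← mul_assoc, oneSubPow_mul_neg, one_mul]

lemma reflect_sub (r : ℤ) (F G : K⟦X⟧) : reflect r (F - G) = reflect r F - reflect r G := by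
  rw [reflect, PowerSeries.subst_sub hasSubst_invParam, mul_sub, reflect, reflect]

/-- Since `u ^ i = (-1) ^ i * X ^ i * t ^ (-i)`, this is a shifted coefficient of `(1 - X) ^ (-(r +
i))`, rewritten by negating the upper index. -/
lemma coeff_oneSubPow_mul_invParam_pow (r : ℤ) {i n : ℕ} (h : i ≤ n) :
    PowerSeries.coeff n (oneSubPow K (-r) * invParam K ^ i) =
      (-1) ^ i * ((Ring.choose ((n : ℤ) + r - 1) (n - i) : ℤ) : K) := by
  obtain ⟨k, rfl⟩ := Nat.exists_eq_add_of_le h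
  have : oneSubPow K (-r) * invParam K ^ i =
      PowerSeries.C ((-1 : K) ^ i) * (PowerSeries.X ^ i * oneSubPow K (-(r + i))) := by
    rw [invParam_pow, neg_add, oneSubPow_add]
    simp only [map_pow, map_neg, map_one]
    ring
  rw [this, PowerSeries.coeff_C_mul, add_comm i k, PowerSeries.coeff_X_pow_mul, coeff_oneSubPow,
    Ring.choose_neg, Nat.add_sub_cancel]
  have e : r + (i : ℤ) + k - 1 = ((k + i : ℕ) : ℤ) + r - 1 := by push_cast; ring
  rw [e]
  congr 1
  rcases Nat.even_or_odd k with hk | hk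
  · simp [hk.neg_one_pow, Int.negOnePow_even _ (Int.even_coe_nat k |>.2 hk)]
  · simp [hk.neg_one_pow, Int.negOnePow_odd _ (Int.odd_coe_nat k |>.2 hk)]

lemma coeff_invParam_pow_of_lt {i n : ℕ} (h : n < i) :
    PowerSeries.coeff n (invParam K ^ i) = 0 := by
  rw [invParam_pow, mul_left_comm, PowerSeries.coeff_X_pow_mul', if_neg (by omega)]

lemma coeff_subst_invParam (G : K⟦X⟧) {n N : ℕ} (h : n < N) :
    PowerSeries.coeff n (PowerSeries.subst (invParam K) G) =
      ∑ i ∈ range N, PowerSeries.coeff i G * PowerSeries.coeff n (invParam K ^ i) := by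
  rw [PowerSeries.coeff_subst' hasSubst_invParam]
  simp only [smul_eq_mul]
  apply finsum_eq_finsetSum_of_support_subset
  intro i hi
  rw [Function.mem_support] at hi
  rw [coe_range, Set.mem_Iio]
  by_contra hc
  exact hi (by rw [coeff_invParam_pow_of_lt (by omega), mul_zero])

lemma coeff_reflect (r : ℤ) (G : K⟦X⟧) (n : ℕ) :
    PowerSeries.coeff n (reflect r G) = ∑ i ∈ range (n + 1),
      (-1) ^ i * ((Ring.choose ((n : ℤ) + r - 1) (n - i) : ℤ) : K) * PowerSeries.coeff i G := by
  have : ∑ i ∈ range (n + 1),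
      (-1) ^ i * ((Ring.choose ((n : ℤ) + r - 1) (n - i) : ℤ) : K) * PowerSeries.coeff i G =
      ∑ i ∈ range (n + 1), ∑ p ∈ antidiagonal n, PowerSeries.coeff p.1 (oneSubPow K (-r)) *
        (PowerSeries.coeff i G * PowerSeries.coeff p.2 (invParam K ^ i)) := by
    refine sum_congr rfl fun i hi ↦ ?_
    rw [mem_range] at hi
    rw [← coeff_oneSubPow_mul_invParam_pow r (by omega), PowerSeries.coeff_mul, sum_mul]
    exact sum_congr rfl fun p _ ↦ by ring
  rw [this, sum_comm, reflect, PowerSeries.coeff_mul]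
  refine sum_congr rfl fun p hp ↦ ?_
  rw [HasAntidiagonal.mem_antidiagonal] at hp
  rw [coeff_subst_invParam G (N := n + 1) (by omega), mul_sum]

/-! ### From the functional equation to fixed points. -/

/-- Frees the substitution from the exact order of the series: `G` may have zero constant term, and
the surplus factor `X ^ k` goes to `u ^ k`. -/
lemma substLaurent_single_mul {u : K⟦X⟧} (hu : PowerSeries.HasSubst u) (hu0 : u ≠ 0) (e : ℤ)
    (G : K⟦X⟧) :
    substLaurent u (HahnSeries.single e (1 : K) * HahnSeries.ofPowerSeries ℤ K G) =
      HahnSeries.ofPowerSeries ℤ K u ^ e *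
        HahnSeries.ofPowerSeries ℤ K (PowerSeries.subst u G) := by
  set H : K⸨X⸩ := HahnSeries.single e (1 : K) * HahnSeries.ofPowerSeries ℤ K G with hH
  have hU : HahnSeries.ofPowerSeries ℤ K u ≠ 0 := fun h ↦
    hu0 (HahnSeries.ofPowerSeries_injective (h.trans (map_zero _).symm))
  have hsubst0 : PowerSeries.subst u (0 : K⟦X⟧) = 0 := by
    rw [← PowerSeries.coe_substAlgHom hu, map_zero]
  by_cases hG : G = 0
  · have : H = 0 := by rw [hH, hG, map_zero, mul_zero]
    rw [substLaurent, this, LaurentSeries.powerSeriesPart_zero, hG, hsubst0]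
    simp
  have hG' : HahnSeries.ofPowerSeries ℤ K G ≠ 0 := fun h ↦
    hG (HahnSeries.ofPowerSeries_injective (h.trans (map_zero _).symm))
  have hord : ∃ k : ℕ, H.order = e + k := by
    refine ⟨(HahnSeries.ofPowerSeries ℤ K G).order.toNat, ?_⟩
    have hnn : 0 ≤ (HahnSeries.ofPowerSeries ℤ K G).order := by
      by_contra hneg
      have := HahnSeries.coeff_order_eq_zero.not.2 hG'
      rw [PowerSeries.coeff_coe, if_pos (by omega)] at this
      exact this rfl
    rw [hH, HahnSeries.order_mul (by simp) hG', HahnSeries.order_single one_ne_zero]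
    omega
  obtain ⟨k, hk⟩ := hord
  have hP := LaurentSeries.single_order_mul_powerSeriesPart H
  have hGP : G = PowerSeries.X ^ k * H.powerSeriesPart := by
    apply HahnSeries.ofPowerSeries_injective (Γ := ℤ)
    rw [map_mul, HahnSeries.ofPowerSeries_X_pow]
    have hs : (HahnSeries.single e (1 : K)) ≠ 0 := by simp
    apply mul_left_cancel₀ hs
    rw [← hH, ← mul_assoc, HahnSeries.single_mul_single, one_mul, ← hk, hP]
  have hsub : PowerSeries.subst u G = u ^ k * PowerSeries.subst u H.powerSeriesPart := by
    conv_lhs => rw [hGP]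
    rw [PowerSeries.subst_mul hu, PowerSeries.subst_pow hu, PowerSeries.subst_X hu]
  rw [substLaurent, hsub, hk, map_mul, map_pow, zpow_add₀ hU, zpow_natCast, mul_assoc]

lemma functionalEquation_iff_reflect_eq (d a : ℤ) (G : K⟦X⟧) :
    FunctionalEquation d a (HahnSeries.single (-d) (1 : K) * HahnSeries.ofPowerSeries ℤ K G) ↔
      reflect (-(a + d)) G = G := by
  have ht : t K ≠ 0 := by
    rw [← zpow_one (t K), ← ofPowerSeries_oneSubPow]
    intro h
    have := oneSubPow_mul_neg (K := K) 1
    rw [HahnSeries.ofPowerSeries_injective (h.trans (map_zero _).symm)] at this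
    simp at this
  have hu0 : invParam K ≠ 0 := by
    intro h
    rw [invParam_eq_neg_X_mul, neg_eq_zero] at h
    rcases mul_eq_zero.1 h with h | h
    · exact PowerSeries.X_ne_zero h
    · have := oneSubPow_mul_neg (K := K) 1
      rw [h] at this
      simp at this
  have hu : HahnSeries.ofPowerSeries ℤ K (invParam K) ^ (-d) =
      (-1) ^ d * (HahnSeries.single (-d) (1 : K) * t K ^ d) := by
    rw [invParam_eq_neg_X_mul, map_neg, map_mul, ofPowerSeries_oneSubPow,
      HahnSeries.ofPowerSeries_X, neg_eq_neg_one_mul, mul_zpow, mul_zpow, ← RatFunc.single_zpow,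
      ← zpow_mul]
    simp only [zpow_neg, neg_mul, one_mul, neg_neg, ← inv_zpow, inv_neg, inv_one]
  have hs : ((-1) ^ d * HahnSeries.single (-d) (1 : K) : K⸨X⸩) ≠ 0 :=
    mul_ne_zero (zpow_ne_zero _ (by simp)) (by simp)
  rw [FunctionalEquation, evalInv, substLaurent_single_mul hasSubst_invParam hu0, hu, reflect,
    ← (HahnSeries.ofPowerSeries_injective (Γ := ℤ) (R := K)).eq_iff, map_mul,
    ofPowerSeries_oneSubPow, neg_neg, zpow_add₀ ht, zpow_neg]
  have hta : t K ^ a ≠ 0 := zpow_ne_zero _ ht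
  constructor
  · intro h
    field_simp at h
    linear_combination h
  · intro h
    rw [← h]
    field_simp

/-! ### Antiinvariant functionals. -/

/-- The coefficient with which `(-1) ^ i * γ i` contributes to the `n`-th coefficient of
`reflect r G`, where `γ` is the coefficient sequence of `G`. -/
def reflectCoeff (K : Type*) [Field K] (r n : ℤ) (i : ℕ) : K :=
  if (i : ℤ) ≤ n then ((Ring.choose (n + r - 1) (n - i).toNat : ℤ) : K) else 0

lemma coeff_coe_reflect (r : ℤ) (G : K⟦X⟧) {n : ℤ} {N : ℕ} (h : n < N) :
    (HahnSeries.ofPowerSeries ℤ K (reflect r G)).coeff n =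
      ∑ i ∈ range N, (-1) ^ i * reflectCoeff K r n i * PowerSeries.coeff i G := by
  rw [PowerSeries.coeff_coe]
  split_ifs with hn
  · refine (sum_eq_zero fun i _ ↦ ?_).symm
    rw [reflectCoeff, if_neg (by omega), mul_zero, zero_mul]
  · obtain ⟨m, rfl⟩ := Int.eq_ofNat_of_zero_le (not_lt.1 hn)
    rw [Int.natAbs_natCast, coeff_reflect]
    have hsub : range (m + 1) ⊆ range N := range_subset_range.2 (by omega)
    rw [← sum_subset hsub]
    · refine sum_congr rfl fun i hi ↦ ?_
      rw [mem_range] at hi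
      rw [reflectCoeff, if_pos (by omega), show ((m : ℤ) - i).toNat = m - i by omega]
    · intro i _ hi
      rw [mem_range] at hi
      rw [reflectCoeff, if_neg (by omega), mul_zero, zero_mul]

lemma coeff_coe_eq_sum (G : K⟦X⟧) {n : ℤ} {N : ℕ} (h : n < N) :
    (HahnSeries.ofPowerSeries ℤ K G).coeff n =
      ∑ i ∈ range N, if n = i then PowerSeries.coeff i G else 0 := by
  rw [PowerSeries.coeff_coe]
  split_ifs with hn
  · exact (sum_eq_zero fun i _ ↦ if_neg (by omega)).symm
  · obtain ⟨m, rfl⟩ := Int.eq_ofNat_of_zero_le (not_lt.1 hn)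
    rw [Int.natAbs_natCast]
    simp only [Nat.cast_inj]
    rw [sum_ite_eq, if_pos (mem_range.2 (by omega))]

/-- The linear functional `G ↦ ∑ k < M, c k * γ (s + k)`, with `γ` the coefficient sequence of
`G`, is negated by precomposition with `reflect r`. -/
def IsAntiinvariant (r s : ℤ) (M : ℕ) (c : ℕ → K) : Prop :=
  ∀ i : ℕ, (-1) ^ i * ∑ k ∈ range M, c k * reflectCoeff K r (s + k) i =
    -∑ k ∈ range M, if s + k = i then c k else 0

lemma IsAntiinvariant.sum_reflect {r s : ℤ} {M : ℕ} {c : ℕ → K} (hc : IsAntiinvariant r s M c)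
    (G : K⟦X⟧) :
    ∑ k ∈ range M, c k * (HahnSeries.ofPowerSeries ℤ K (reflect r G)).coeff (s + k) =
      -∑ k ∈ range M, c k * (HahnSeries.ofPowerSeries ℤ K G).coeff (s + k) := by
  obtain ⟨N, hN⟩ : ∃ N : ℕ, ∀ k ∈ range M, s + (k : ℤ) < N :=
    ⟨s.toNat + M + 1, fun k hk ↦ by rw [mem_range] at hk; omega⟩
  have hl : ∀ k ∈ range M, c k * (HahnSeries.ofPowerSeries ℤ K (reflect r G)).coeff (s + k) =
      ∑ i ∈ range N, (-1) ^ i * (c k * reflectCoeff K r (s + k) i) * PowerSeries.coeff i G := by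
    intro k hk
    rw [coeff_coe_reflect r G (hN k hk), mul_sum]
    exact sum_congr rfl fun i _ ↦ by ring
  have hr : ∀ k ∈ range M, c k * (HahnSeries.ofPowerSeries ℤ K G).coeff (s + k) =
      ∑ i ∈ range N, (if s + k = i then c k else 0) * PowerSeries.coeff i G := by
    intro k hk
    rw [coeff_coe_eq_sum G (hN k hk), mul_sum]
    exact sum_congr rfl fun i _ ↦ by split_ifs <;> simp
  rw [sum_congr rfl hl, sum_congr rfl hr, sum_comm, sum_comm (s := range M), ← sum_neg_distrib]
  refine sum_congr rfl fun i _ ↦ ?_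
  rw [← sum_mul, ← mul_sum, hc i, ← sum_mul, neg_mul]

lemma IsAntiinvariant.sum_eq_zero [CharZero K] {r s : ℤ} {M : ℕ} {c : ℕ → K}
    (hc : IsAntiinvariant r s M c) {G : K⟦X⟧} (hG : reflect r G = G) :
    ∑ k ∈ range M, c k * (HahnSeries.ofPowerSeries ℤ K G).coeff (s + k) = 0 := by
  have := hc.sum_reflect G
  rwa [hG, self_eq_neg] at this

/-- If, for each odd `n`, some antiinvariant functional with leading index `n` vanishes on `G`,
then `G` is fixed by `reflect r`. -/
lemma reflect_eq_self_of_forall_odd [CharZero K] {r : ℤ} {G : K⟦X⟧}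
    (h : ∀ n : ℕ, Odd n → ∃ (s : ℤ) (M : ℕ) (c : ℕ → K), IsAntiinvariant r s (M + 1) c ∧
      s + M = n ∧ c M ≠ 0 ∧
      ∑ k ∈ range (M + 1), c k * (HahnSeries.ofPowerSeries ℤ K G).coeff (s + k) = 0) :
    reflect r G = G := by
  rw [← sub_eq_zero]
  set E := reflect r G - G with hE
  have hneg : reflect r E = -E := by rw [hE, reflect_sub, reflect_reflect, neg_sub]
  ext n
  rw [map_zero]
  induction n using Nat.strong_induction_on with
  | _ n ih =>
  rcases Nat.even_or_odd n with hn | hn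
  -- Only the diagonal term survives, giving `-E n = E n`.
  · have := coeff_reflect r E n
    rw [hneg, map_neg, sum_range_succ, sum_eq_zero, zero_add, hn.neg_one_pow, Nat.sub_self,
      Ring.choose_zero_right, Int.cast_one, one_mul, one_mul, neg_eq_self] at this
    · exact this
    · intro i hi
      rw [ih i (mem_range.1 hi), mul_zero]
  · obtain ⟨s, M, c, hc, hs, hM, hsum⟩ := h n hn
    have : ∑ k ∈ range (M + 1), c k * (HahnSeries.ofPowerSeries ℤ K E).coeff (s + k) = 0 := by
      simp only [hE, map_sub, HahnSeries.coeff_sub, mul_sub, sum_sub_distrib]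
      rw [hc.sum_reflect, hsum, neg_zero, sub_zero]
    rw [sum_range_succ, Finset.sum_eq_zero, zero_add, hs, mul_eq_zero] at this
    · simpa [PowerSeries.coeff_coe] using this.resolve_left hM
    · intro k hk
      rw [mem_range] at hk
      rw [PowerSeries.coeff_coe]
      split_ifs
      · rw [mul_zero]
      · rw [ih _ (by omega), mul_zero]

/-! ### Finite differences of binomial coefficients. -/

lemma sum_ite_add_eq {s : ℤ} {i j : ℕ} (h : (i : ℤ) = s + j) (M : ℕ) (c : ℕ → K) :
    (∑ k ∈ range M, if s + k = i then c k else 0) = if j < M then c j else 0 := by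
  have (k : ℕ) : s + k = i ↔ j = k := by omega
  simp only [this, sum_ite_eq, mem_range]

lemma sum_ite_add_eq_zero {s : ℤ} {i : ℕ} (h : (i : ℤ) < s) (M : ℕ) (c : ℕ → K) :
    (∑ k ∈ range M, if s + k = i then c k else 0) = 0 :=
  sum_eq_zero fun k _ ↦ if_neg (by omega)

lemma sum_range_succ_alternating_choose_succ (s : ℕ) (f : ℕ → K) :
    ∑ k ∈ range (s + 2), (-1) ^ k * ((s + 1).choose k : K) * f k =
      ∑ k ∈ range (s + 1), (-1) ^ k * (s.choose k : K) * (f k - f (k + 1)) := by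
  have h : ∑ k ∈ range (s + 2), (-1) ^ k * (s.choose k : K) * f k =
      ∑ k ∈ range (s + 1), (-1) ^ k * (s.choose k : K) * f k := by
    rw [sum_range_succ, Nat.choose_succ_self, Nat.cast_zero, mul_zero, zero_mul, add_zero]
  simp only [mul_sub, sum_sub_distrib]
  rw [← h, sum_range_succ', sum_range_succ' _ (s + 1), add_sub_right_comm, ← sum_sub_distrib]
  simp only [pow_zero, Nat.choose_zero_right]
  congr 1
  refine sum_congr rfl fun k _ ↦ ?_
  rw [Nat.choose_succ_succ]
  push_cast
  ring

/-- The `s`-th finite difference of `x ↦ x.choose p`. -/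
lemma sum_alternating_choose_mul_choose (s x p : ℕ) :
    ∑ k ∈ range (s + 1), (-1) ^ k * (s.choose k : K) * ((x + k).choose p : K) =
      if s ≤ p then (-1) ^ s * (x.choose (p - s) : K) else 0 := by
  induction s generalizing p with
  | zero => simp
  | succ s ih =>
    rw [sum_range_succ_alternating_choose_succ]
    cases p with
    | zero => simp
    | succ p =>
      have h (k : ℕ) : ((x + k).choose (p + 1) : K) - ((x + (k + 1)).choose (p + 1) : K) =
          -((x + k).choose p : K) := by
        rw [← add_assoc, Nat.choose_succ_succ]
        push_cast
        ring
      simp only [h, mul_neg, sum_neg_distrib, ih, Nat.add_le_add_iff_right, Nat.add_sub_add_right]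
      split_ifs <;> ring

lemma reflectCoeff_eq_choose {r n : ℤ} {i y l : ℕ} (hy : n + r - 1 = y) (hl : (i : ℤ) + r - 1 = l) :
    reflectCoeff K r n i = (y.choose l : K) := by
  rw [reflectCoeff]
  split_ifs with h
  · rw [hy, Ring.choose_natCast, show (n - i).toNat = y - l by omega, Nat.choose_symm (by omega)]
    simp
  · rw [Nat.choose_eq_zero_of_lt (by omega), Nat.cast_zero]

lemma reflectCoeff_eq_zero {r n : ℤ} {i y : ℕ} (hy : n + r - 1 = y) (hl : (i : ℤ) + r - 1 < 0) :
    reflectCoeff K r n i = 0 := by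
  rw [reflectCoeff]
  split_ifs with h
  · rw [hy, Ring.choose_natCast, Nat.choose_eq_zero_of_lt (by omega)]
    simp
  · rfl

lemma neg_one_pow_mul_neg_one_pow {i m j : ℕ} (h : Odd (i + m + j)) :
    (-1 : K) ^ i * (-1) ^ m = -(-1) ^ j := by
  rw [← pow_add]
  rcases Nat.even_or_odd j with hj | hj
  · rw [(Nat.odd_add.1 h |>.2 hj).neg_one_pow, hj.neg_one_pow]
  · rw [hj.neg_one_pow, Even.neg_one_pow, neg_neg]
    rw [Nat.odd_iff] at h hj
    rw [Nat.even_iff]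
    omega

/-! ### The four antiinvariant families. -/

/-- The start `m + 1 - r` turns the upper index `n + r - 1` into `m + k`, so the sum is an `m`-th
finite difference. The leading index `2 * m + 1 - r` is odd. -/
lemma isAntiinvariant_of_even {r : ℤ} (hr : Even r) (m : ℕ) :
    IsAntiinvariant r ((m + 1 : ℕ) - r) (m + 1) fun k ↦ (-1 : K) ^ k * (m.choose k : K) := by
  intro i
  by_cases hi : (i : ℤ) + r - 1 < 0
  · rw [sum_ite_add_eq_zero (by omega), Finset.sum_eq_zero]
    · simp
    · intro k _
      rw [reflectCoeff_eq_zero (y := m + k) (by push_cast; ring) hi, mul_zero]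
  · obtain ⟨l, hl⟩ := Int.eq_ofNat_of_zero_le (not_lt.1 hi)
    rw [sum_congr rfl fun k _ ↦ by
      rw [reflectCoeff_eq_choose (y := m + k) (by push_cast; ring) hl],
      sum_alternating_choose_mul_choose]
    split_ifs with hml
    · obtain ⟨j, rfl⟩ := Nat.exists_eq_add_of_le hml
      rw [sum_ite_add_eq (j := j) (by push_cast at *; omega), Nat.add_sub_cancel_left]
      -- Here `i + m + j = 2 * (m + j) + 1 - r`, which is odd exactly because `r` is even.
      have hpar : (-1 : K) ^ i * (-1) ^ m = -(-1) ^ j := by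
        apply neg_one_pow_mul_neg_one_pow
        rw [Int.even_iff] at hr
        rw [Nat.odd_iff]
        push_cast at *
        omega
      split_ifs with hj
      · rw [← mul_assoc, hpar, neg_mul]
      · rw [Nat.choose_eq_zero_of_lt (by omega)]; simp
    · rw [sum_ite_add_eq_zero (by omega)]; simp

/-- With `h = μ + k`, the product of the binomials with indices `ρ + h` and `i + ρ` factors by
trinomial revision into a constant times `s.choose q`, where `h = i + q` and `s = 2 * μ + 1 - i`.
What remains is an `s`-th finite difference of `(h + 1).choose (μ + 1)`. -/
lemma isAntiinvariant_of_pos (μ ρ : ℕ) :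
    IsAntiinvariant ((ρ + 1 : ℕ) : ℤ) (μ : ℤ) (μ + 2) fun k ↦
      (-1 : K) ^ k * ((2 * μ + 1 + ρ).choose (μ + 1 - k) : K) * ((μ + 1 + k).choose k : K) := by
  intro i
  have hcoeff (k : ℕ) : reflectCoeff K ((ρ + 1 : ℕ) : ℤ) ((μ : ℤ) + k) i =
      ((μ + ρ + k).choose (i + ρ) : K) :=
    reflectCoeff_eq_choose (by push_cast; ring) (by push_cast; ring)
  simp only [hcoeff]
  by_cases hi : 2 * μ + 1 < i
  · rw [Finset.sum_eq_zero, sum_ite_add_eq (j := i - μ) (by omega), if_neg (by omega)]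
    · simp
    · intro k hk
      rw [mem_range] at hk
      rw [Nat.choose_eq_zero_of_lt (by omega : μ + ρ + k < i + ρ), Nat.cast_zero, mul_zero]
  obtain ⟨s, hs⟩ := Nat.exists_eq_add_of_le (not_lt.1 hi)
  -- The summand in terms of `h = μ + k`. It vanishes for `h < μ` and for `h < i`, so the sums over
  -- `μ ≤ h ≤ 2 * μ + 1` and `i ≤ h ≤ 2 * μ + 1` agree.
  set f : ℕ → K := fun h ↦ (-1) ^ (h + μ) * ((2 * μ + 1 + ρ).choose (ρ + h) : K) *
    ((h + 1).choose (μ + 1) : K) * ((ρ + h).choose (i + ρ) : K) with hf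
  have hsum : ∑ k ∈ range (μ + 2), (-1 : K) ^ k * ((2 * μ + 1 + ρ).choose (μ + 1 - k) : K) *
      ((μ + 1 + k).choose k : K) * ((μ + ρ + k).choose (i + ρ) : K) =
      ∑ q ∈ range (s + 1), f (i + q) := by
    have h1 := sum_range_add f μ (μ + 2)
    have h2 := sum_range_add f i (s + 1)
    rw [Finset.sum_eq_zero (s := range μ), zero_add] at h1
    · rw [Finset.sum_eq_zero (s := range i), zero_add] at h2
      · rw [← h2, show i + (s + 1) = μ + (μ + 2) by omega, h1]
        refine sum_congr rfl fun k hk ↦ ?_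
        rw [mem_range] at hk
        rw [hf]
        have e1 : (2 * μ + 1 + ρ).choose (μ + 1 - k) = (2 * μ + 1 + ρ).choose (ρ + (μ + k)) := by
          apply Nat.choose_symm_of_eq_add
          omega
        have e2 : (μ + 1 + k).choose k = (μ + k + 1).choose (μ + 1) := by
          rw [show μ + k + 1 = μ + 1 + k by ring]
          exact Nat.choose_symm_add.symm
        have e3 : (-1 : K) ^ (μ + k + μ) = (-1) ^ k := by
          rw [show μ + k + μ = k + 2 * μ by ring, pow_add, pow_mul]
          simp
        simp only [e1, e2, e3]
        rw [show μ + ρ + k = ρ + (μ + k) by ring]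
      · intro h hh
        rw [mem_range] at hh
        simp only [hf]
        rw [Nat.choose_eq_zero_of_lt (by omega : ρ + h < i + ρ), Nat.cast_zero, mul_zero]
    · intro h hh
      rw [mem_range] at hh
      simp only [hf]
      rw [Nat.choose_eq_zero_of_lt (by omega : h + 1 < μ + 1), Nat.cast_zero, mul_zero, zero_mul]
  have hterm (q : ℕ) : f (i + q) = (-1) ^ (i + μ) * ((2 * μ + 1 + ρ).choose (i + ρ) : K) *
      ((-1) ^ q * (s.choose q : K) * ((i + 1 + q).choose (μ + 1) : K)) := by
    have : ((2 * μ + 1 + ρ).choose (ρ + (i + q)) : K) * ((ρ + (i + q)).choose (i + ρ) : K) =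
        ((2 * μ + 1 + ρ).choose (i + ρ) : K) * (s.choose q : K) := by
      rw [show ρ + (i + q) = i + ρ + q by ring]
      have hle : i + ρ ≤ i + ρ + q := Nat.le_add_right _ _
      have := Nat.choose_mul (n := 2 * μ + 1 + ρ) hle
      rw [show 2 * μ + 1 + ρ - (i + ρ) = s by omega, Nat.add_sub_cancel_left] at this
      rw [← Nat.cast_mul, this, Nat.cast_mul]
    simp only [hf]
    rw [show i + q + μ = i + μ + q by ring, pow_add _ (i + μ), show i + q + 1 = i + 1 + q by ring]
    linear_combination (-1) ^ (i + μ) * (-1) ^ q * ((i + 1 + q).choose (μ + 1) : K) * this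
  rw [hsum, sum_congr rfl fun q _ ↦ hterm q, ← mul_sum, sum_alternating_choose_mul_choose]
  split_ifs with hsμ
  · obtain ⟨k, rfl⟩ : ∃ k, i = μ + k := Nat.exists_eq_add_of_le (by omega)
    rw [sum_ite_add_eq (j := k) (by push_cast; ring), if_pos (by omega)]
    have e1 : (2 * μ + 1 + ρ).choose (μ + 1 - k) = (2 * μ + 1 + ρ).choose (μ + k + ρ) := by
      apply Nat.choose_symm_of_eq_add
      omega
    have e2 : (μ + 1 + k).choose k = (μ + k + 1).choose (μ + 1 - s) := by
      rw [show μ + 1 - s = k by omega, show μ + k + 1 = μ + 1 + k by ring]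
    have hpar : (-1 : K) ^ (μ + k) * (-1) ^ (μ + k + μ + s) = -(-1) ^ k := by
      apply neg_one_pow_mul_neg_one_pow
      rw [Nat.odd_iff]
      omega
    rw [pow_add _ (μ + k + μ) s] at hpar
    rw [e1, e2]
    linear_combination ((2 * μ + 1 + ρ).choose (μ + k + ρ) : K) *
      ((μ + k + 1).choose (μ + 1 - s) : K) * hpar
  · rw [sum_ite_add_eq_zero (by omega)]
    simp

/-- Trinomial revision: weighting by inverse binomials conjugates the matrix of the involution, in
degrees up to `N`, to a signed Pascal matrix. This explains the inverse binomials in the third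
condition. -/
lemma reflectCoeff_mul_inv_choose [CharZero K] {N n : ℕ} (hn : n ≤ N) (i : ℕ) :
    ((N + 1).choose (n + 1) : K)⁻¹ * reflectCoeff K (-(N : ℤ)) n i =
      (-1) ^ (n + i) * ((n + 1).choose (i + 1) : K) * ((N + 1).choose (i + 1) : K)⁻¹ := by
  rw [reflectCoeff]
  split_ifs with h
  · obtain ⟨k, rfl⟩ := Nat.exists_eq_add_of_le (Int.ofNat_le.1 h)
    obtain ⟨p, rfl⟩ := Nat.exists_eq_add_of_le hn
    have e : ((Ring.choose (((i + k : ℕ) : ℤ) + -((i + k + p : ℕ) : ℤ) - 1) k : ℤ) : K) =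
        (-1) ^ k * ((k + p).choose k : K) := by
      rw [show ((i + k : ℕ) : ℤ) + -((i + k + p : ℕ) : ℤ) - 1 = -((p + 1 : ℕ) : ℤ) by
        push_cast; ring, Ring.choose_neg, show ((p + 1 : ℕ) : ℤ) + k - 1 = (k + p : ℕ) by
        push_cast; ring, Ring.choose_natCast]
      rcases Nat.even_or_odd k with hk | hk
      · simp [hk.neg_one_pow, Int.negOnePow_even _ (Int.even_coe_nat k |>.2 hk)]
      · simp [hk.neg_one_pow, Int.negOnePow_odd _ (Int.odd_coe_nat k |>.2 hk)]
    rw [show (((i + k : ℕ) : ℤ) - i).toNat = k by omega, e]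
    have h1 : ((i + k + p + 1).choose (i + k + 1) : K) ≠ 0 :=
      Nat.cast_ne_zero.2 (Nat.choose_pos (by omega)).ne'
    have h2 : ((i + k + p + 1).choose (i + 1) : K) ≠ 0 :=
      Nat.cast_ne_zero.2 (Nat.choose_pos (by omega)).ne'
    have key : ((i + k + p + 1).choose (i + k + 1) : K) * ((i + k + 1).choose (i + 1) : K) =
        ((i + k + p + 1).choose (i + 1) : K) * ((k + p).choose k : K) := by
      have := Nat.choose_mul (n := i + k + p + 1) (show i + 1 ≤ i + k + 1 by omega)
      rw [show i + k + p + 1 - (i + 1) = k + p by omega,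
        show i + k + 1 - (i + 1) = k by omega] at this
      exact_mod_cast this
    have hpar : (-1 : K) ^ (i + k + i) = (-1) ^ k := by
      rw [show i + k + i = k + 2 * i by ring, pow_add, pow_mul]
      simp
    rw [hpar]
    field_simp
    linear_combination -key
  · rw [Nat.choose_eq_zero_of_lt (by omega : n + 1 < i + 1)]
    simp

/-- The bound keeps every index `μ + k` at most `N`, where the weights are inverses of nonzero
binomials. -/
lemma isAntiinvariant_of_neg [CharZero K] {N μ : ℕ} (h : 2 * μ + 1 ≤ N) :
    IsAntiinvariant (-(N : ℤ)) (μ : ℤ) (μ + 2) fun k ↦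
      ((μ + 1).choose k : K) * ((N + 1).choose (μ + 1 + k) : K)⁻¹ := by
  intro i
  have hterm : ∀ k ∈ range (μ + 2), ((μ + 1).choose k : K) * ((N + 1).choose (μ + 1 + k) : K)⁻¹ *
      reflectCoeff K (-(N : ℤ)) ((μ : ℤ) + k) i = (-1) ^ (μ + i) * ((N + 1).choose (i + 1) : K)⁻¹ *
        ((-1) ^ k * ((μ + 1).choose k : K) * ((μ + 1 + k).choose (i + 1) : K)) := by
    intro k hk
    rw [mem_range] at hk
    have := reflectCoeff_mul_inv_choose (K := K) (n := μ + k) (N := N) (by omega) i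
    rw [Nat.cast_add, show μ + k + 1 = μ + 1 + k by ring, show μ + k + i = μ + i + k by ring,
      pow_add _ (μ + i)] at this
    linear_combination ((μ + 1).choose k : K) * this
  rw [sum_congr rfl hterm, ← mul_sum, sum_alternating_choose_mul_choose]
  split_ifs with hi
  · obtain ⟨k, rfl⟩ : ∃ k, i = μ + k := Nat.exists_eq_add_of_le (by omega)
    rw [sum_ite_add_eq (j := k) (by push_cast; ring), show μ + k + 1 - (μ + 1) = k by omega]
    have hpar : (-1 : K) ^ (μ + k) * (-1) ^ (μ + (μ + k) + (μ + 1)) = -(-1) ^ (2 * μ) := by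
      apply neg_one_pow_mul_neg_one_pow
      rw [Nat.odd_iff]
      omega
    rw [pow_mul, neg_one_sq, one_pow, pow_add _ (μ + (μ + k))] at hpar
    rw [show μ + 1 + k = μ + k + 1 by ring]
    split_ifs with hk
    · linear_combination ((N + 1).choose (μ + k + 1) : K)⁻¹ * ((μ + 1).choose k : K) * hpar
    · rw [Nat.choose_eq_zero_of_lt (by omega : μ + 1 < k)]
      simp
  · rw [sum_ite_add_eq_zero (by omega)]
    simp

/-- The factor `μ + 1 + k` is absorbed by `(μ + k).choose l`, giving `(l + 1) * (μ + k + 1).choose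
(l + 1)`, to which a difference of order `μ + 1` applies. The leading index `2 * (μ + 1) + N` is odd
because `N` is. -/
lemma isAntiinvariant_of_neg_odd [CharZero K] {N : ℕ} (hN : Odd N) (μ : ℕ) :
    IsAntiinvariant (-(N : ℤ)) ((μ + 1 : ℕ) - -(N : ℤ)) (μ + 2) fun k ↦
      (-1 : K) ^ k * ((μ + 1).choose k : K) * ((((μ + 1 : ℕ) : K) + k) / ((μ + 1 : ℕ) : K)) := by
  intro i
  have hμ : ((μ + 1 : ℕ) : K) ≠ 0 := Nat.cast_ne_zero.2 μ.succ_ne_zero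
  by_cases hi : (i : ℤ) + -(N : ℤ) - 1 < 0
  · rw [sum_ite_add_eq_zero (by omega), Finset.sum_eq_zero]
    · simp
    · intro k _
      rw [reflectCoeff_eq_zero (y := μ + k) (by push_cast; ring) hi, mul_zero]
  obtain ⟨l, hl⟩ := Int.eq_ofNat_of_zero_le (not_lt.1 hi)
  have hterm (k : ℕ) : (-1 : K) ^ k * ((μ + 1).choose k : K) *
      ((((μ + 1 : ℕ) : K) + k) / ((μ + 1 : ℕ) : K)) *
        reflectCoeff K (-(N : ℤ)) ((μ + 1 : ℕ) - -(N : ℤ) + k) i =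
      ((l + 1 : ℕ) : K) / ((μ + 1 : ℕ) : K) *
        ((-1) ^ k * ((μ + 1).choose k : K) * ((μ + 1 + k).choose (l + 1) : K)) := by
    rw [reflectCoeff_eq_choose (y := μ + k) (by push_cast; ring) hl]
    have key : ((μ + k + 1 : ℕ) : K) * ((μ + k).choose l : K) =
        ((μ + k + 1).choose (l + 1) : K) * ((l + 1 : ℕ) : K) := by
      exact_mod_cast Nat.add_one_mul_choose_eq (μ + k) l
    rw [show μ + 1 + k = μ + k + 1 by ring]
    field_simp
    push_cast at key ⊢
    linear_combination ((μ + 1).choose k : K) * key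
  rw [sum_congr rfl fun k _ ↦ hterm k, ← mul_sum, sum_alternating_choose_mul_choose]
  split_ifs with hlμ
  · obtain ⟨j, rfl⟩ : ∃ j, l = μ + j := Nat.exists_eq_add_of_le (by omega)
    rw [sum_ite_add_eq (j := j) (by push_cast at *; omega), show μ + j + 1 - (μ + 1) = j by omega]
    have hpar : (-1 : K) ^ i * (-1) ^ (μ + 1) = -(-1) ^ j := by
      apply neg_one_pow_mul_neg_one_pow
      rw [Nat.odd_iff] at hN ⊢
      push_cast at *
      omega
    split_ifs with hj
    · rw [show ((μ + j + 1 : ℕ) : K) = ((μ + 1 : ℕ) : K) + j by push_cast; ring]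
      linear_combination (((μ + 1 : ℕ) : K) + j) / ((μ + 1 : ℕ) : K) *
        ((μ + 1).choose j : K) * hpar
    · rw [Nat.choose_eq_zero_of_lt (by omega : μ + 1 < j)]
      simp
  · rw [sum_ite_add_eq_zero (by omega)]
    simp

end LaurentAtOne

end

/-! ### Assembling the equivalence. -/

theorem theorem1p1 {K : Type*} [Field K] [CharZero K] (d a r : ℤ) (hr : r = -(a + d))
    (γ : ℤ → K) (hγ : ∀ i : ℤ, i < 0 → γ i = 0)
    (H : LaurentSeries K) (hH : ∀ i : ℤ, H.coeff (i - d) = γ i) :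
    LaurentAtOne.FunctionalEquation d a H ↔
      (Even r → ∀ m : ℕ, 1 ≤ m →
        ∑ i ∈ Finset.range m, (-1 : K) ^ i * (Nat.choose (m - 1) i : K) * γ (m - r + i) = 0) ∧
      (0 < r → Odd r → ∀ m : ℕ, 1 ≤ m →
        ∑ i ∈ Finset.range (m + 1),
          (-1 : K) ^ i * (Nat.choose (2 * (m : ℤ) + r - 2).toNat (m - i) : K) *
            (Nat.choose (m + i) i : K) * γ (m + i - 1) = 0) ∧
      (r < 0 → ∀ m : ℕ, 1 ≤ m → (m : ℤ) ≤ ⌈-(r : ℚ) / 2⌉ →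
        ∑ i ∈ Finset.range (m + 1),
          (Nat.choose m i : K) * (Nat.choose (1 - r).toNat (m + i) : K)⁻¹ * γ (m + i - 1) = 0) ∧
      (r < 0 → Odd r → ∀ m : ℕ, 1 ≤ m →
        ∑ i ∈ Finset.range (m + 1),
          (-1 : K) ^ i * (Nat.choose m i : K) * (((m : K) + (i : K)) / (m : K)) *
            γ (m - r + i) = 0) := by
  set G : PowerSeries K := PowerSeries.mk fun n : ℕ ↦ γ n with hG
  have hγG (n : ℤ) : γ n = (HahnSeries.ofPowerSeries ℤ K G).coeff n := by
    rw [PowerSeries.coeff_coe]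
    split_ifs with hn
    · exact hγ n hn
    · rw [hG, PowerSeries.coeff_mk, Int.natAbs_of_nonneg (not_lt.1 hn)]
  have hHG : H = HahnSeries.single (-d) (1 : K) * HahnSeries.ofPowerSeries ℤ K G := by
    ext n
    have h1 := hH (n + d)
    rw [add_sub_cancel_right] at h1
    have h2 := HahnSeries.coeff_single_mul_add (r := (1 : K)) (b := -d) (a := n + d)
      (x := HahnSeries.ofPowerSeries ℤ K G)
    rw [add_neg_cancel_right, one_mul] at h2
    rw [h1, h2, hγG]
  rw [hHG, LaurentAtOne.functionalEquation_iff_reflect_eq, ← hr]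
  have cond_pos {ρ : ℕ} (hρ : r = (ρ + 1 : ℕ)) (μ : ℕ) :
      ∑ i ∈ Finset.range (μ + 1 + 1),
        (-1 : K) ^ i * (Nat.choose (2 * ((μ + 1 : ℕ) : ℤ) + r - 2).toNat (μ + 1 - i) : K) *
          (Nat.choose (μ + 1 + i) i : K) * γ ((μ + 1 : ℕ) + i - 1) =
      ∑ k ∈ Finset.range (μ + 2),
        (-1 : K) ^ k * ((2 * μ + 1 + ρ).choose (μ + 1 - k) : K) * ((μ + 1 + k).choose k : K) *
          (HahnSeries.ofPowerSeries ℤ K G).coeff (μ + k) := by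
    refine Finset.sum_congr rfl fun k _ ↦ ?_
    rw [← hγG, show (2 * ((μ + 1 : ℕ) : ℤ) + r - 2).toNat = 2 * μ + 1 + ρ by omega,
      show ((μ + 1 : ℕ) : ℤ) + k - 1 = μ + k by push_cast; ring]
  have cond_neg {N : ℕ} (hN : r = -(N : ℤ)) (μ : ℕ) :
      ∑ i ∈ Finset.range (μ + 1 + 1),
        (Nat.choose (μ + 1) i : K) * (Nat.choose (1 - r).toNat (μ + 1 + i) : K)⁻¹ *
          γ ((μ + 1 : ℕ) + i - 1) =
      ∑ k ∈ Finset.range (μ + 2),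
        ((μ + 1).choose k : K) * ((N + 1).choose (μ + 1 + k) : K)⁻¹ *
          (HahnSeries.ofPowerSeries ℤ K G).coeff (μ + k) := by
    refine Finset.sum_congr rfl fun k _ ↦ ?_
    rw [← hγG, show (1 - r).toNat = N + 1 by omega,
      show ((μ + 1 : ℕ) : ℤ) + k - 1 = μ + k by push_cast; ring]
  -- The ceiling bound says precisely that the leading index `2 * μ + 1` is at most `-r`.
  have le_ceil {N : ℕ} (hN : r = -(N : ℤ)) (μ : ℕ) :
      ((μ + 1 : ℕ) : ℤ) ≤ ⌈-(r : ℚ) / 2⌉ ↔ 2 * μ + 1 ≤ N := by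
    rw [← Int.sub_one_lt_iff, Int.lt_ceil, hN, lt_div_iff₀ two_pos]
    push_cast
    rw [add_sub_cancel_right, neg_neg, Nat.succ_le_iff, mul_comm]
    exact_mod_cast Iff.rfl
  constructor
  · intro hfix
    refine ⟨fun hev m hm ↦ ?_, fun hpos _ m hm ↦ ?_, fun hneg m hm hmr ↦ ?_,
      fun hneg hodd m hm ↦ ?_⟩
    all_goals obtain ⟨μ, rfl⟩ := Nat.exists_eq_add_of_le' hm
    · simpa only [hγG, Nat.add_sub_cancel] using
        (LaurentAtOne.isAntiinvariant_of_even hev μ).sum_eq_zero hfix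
    · obtain ⟨ρ, hρ⟩ : ∃ ρ : ℕ, r = (ρ + 1 : ℕ) := ⟨(r - 1).toNat, by omega⟩
      rw [cond_pos hρ]
      rw [hρ] at hfix
      exact (LaurentAtOne.isAntiinvariant_of_pos μ ρ).sum_eq_zero hfix
    · obtain ⟨N, hN⟩ : ∃ N : ℕ, r = -(N : ℤ) := ⟨(-r).toNat, by omega⟩
      rw [cond_neg hN]
      rw [le_ceil hN] at hmr
      rw [hN] at hfix
      exact (LaurentAtOne.isAntiinvariant_of_neg hmr).sum_eq_zero hfix
    · obtain ⟨N, rfl⟩ : ∃ N : ℕ, r = -(N : ℤ) := ⟨(-r).toNat, by omega⟩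
      have hN : Odd N := by simpa using hodd
      simpa only [hγG] using (LaurentAtOne.isAntiinvariant_of_neg_odd hN μ).sum_eq_zero hfix
  · rintro ⟨h1, h2, h3, h4⟩
    refine LaurentAtOne.reflect_eq_self_of_forall_odd fun n hn ↦ ?_
    have hn' := Nat.odd_iff.1 hn
    have of_pos (hpos : 0 < r) (hodd : Odd r) : ∃ (s : ℤ) (M : ℕ) (c : ℕ → K),
        LaurentAtOne.IsAntiinvariant r s (M + 1) c ∧ s + M = n ∧ c M ≠ 0 ∧
        ∑ k ∈ Finset.range (M + 1),
          c k * (HahnSeries.ofPowerSeries ℤ K G).coeff (s + k) = 0 := by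
      obtain ⟨ρ, hρ⟩ : ∃ ρ : ℕ, r = (ρ + 1 : ℕ) := ⟨(r - 1).toNat, by omega⟩
      refine ⟨(n / 2 : ℕ), n / 2 + 1, _, hρ ▸ LaurentAtOne.isAntiinvariant_of_pos (n / 2) ρ,
        by omega, ?_, ?_⟩
      · refine mul_ne_zero (mul_ne_zero (by simp) ?_) ?_ <;>
          exact Nat.cast_ne_zero.2 (Nat.choose_pos (by omega)).ne'
      · rw [← cond_pos hρ]
        exact h2 hpos hodd _ (by omega)
    have of_neg (hneg : r < 0) (hnr : (n : ℤ) ≤ -r) : ∃ (s : ℤ) (M : ℕ) (c : ℕ → K),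
        LaurentAtOne.IsAntiinvariant r s (M + 1) c ∧ s + M = n ∧ c M ≠ 0 ∧
        ∑ k ∈ Finset.range (M + 1),
          c k * (HahnSeries.ofPowerSeries ℤ K G).coeff (s + k) = 0 := by
      obtain ⟨N, hN⟩ : ∃ N : ℕ, r = -(N : ℤ) := ⟨(-r).toNat, by omega⟩
      have hle : 2 * (n / 2) + 1 ≤ N := by omega
      refine ⟨(n / 2 : ℕ), n / 2 + 1, _, hN ▸ LaurentAtOne.isAntiinvariant_of_neg hle,
        by omega, ?_, ?_⟩
      · refine mul_ne_zero ?_ (inv_ne_zero ?_) <;>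
          exact Nat.cast_ne_zero.2 (Nat.choose_pos (by omega)).ne'
      · rw [← cond_neg hN]
        exact h3 hneg _ (by omega) ((le_ceil hN _).2 hle)
    -- Choice of family for odd `n`: the second if `r` is positive and odd; otherwise the third if
    -- `n ≤ -r`, and beyond that the first or the fourth according to the parity of `r`.
    rcases Int.even_or_odd r with hev | hodd
    · have hev' := Int.even_iff.1 hev
      by_cases hnr : (n : ℤ) ≤ -r
      · exact of_neg (by omega) hnr
      · obtain ⟨μ, hμ⟩ : ∃ μ : ℕ, (n : ℤ) + r = 2 * μ + 1 := ⟨((n + r) / 2).toNat, by omega⟩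
        refine ⟨_, μ, _, LaurentAtOne.isAntiinvariant_of_even hev μ, by push_cast; omega,
          by simp, ?_⟩
        simpa only [hγG, Nat.add_sub_cancel] using h1 hev (μ + 1) (by omega)
    · have hodd' := Int.odd_iff.1 hodd
      by_cases hpos : 0 < r
      · exact of_pos hpos hodd
      by_cases hnr : (n : ℤ) ≤ -r
      · exact of_neg (by omega) hnr
      · obtain ⟨N, hN⟩ : ∃ N : ℕ, r = -(N : ℤ) := ⟨(-r).toNat, by omega⟩
        obtain ⟨μ, hμ⟩ : ∃ μ : ℕ, (n : ℤ) + r = 2 * (μ + 1) := ⟨((n + r) / 2 - 1).toNat, by omega⟩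
        subst hN
        have hN : Odd N := by simpa using hodd
        refine ⟨_, μ + 1, _, LaurentAtOne.isAntiinvariant_of_neg_odd hN μ, by push_cast; omega,
          ?_, ?_⟩
        · have : (((μ + 1 : ℕ) : K) + (μ + 1 : ℕ)) / ((μ + 1 : ℕ) : K) ≠ 0 := by
            rw [← Nat.cast_add]
            exact div_ne_zero (Nat.cast_ne_zero.2 (by omega)) (Nat.cast_ne_zero.2 (by omega))
          simpa using this
        · simpa only [hγG] using h4 (by omega) hodd (μ + 1) (by omega)
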